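/- Let $A$ be a unital C*-algebra, let $\mathcal C(A)$ be the poset of its unital commutative C*-subalgebras ordered by inclusion, and let $\mathcal T(A)=\mathbf{Sets}^{\mathcal C(A)}$. All notions below are interpreted in the internal (Kripke–Joyal) language of $\mathcal T(A)$; recall that the power object of an object $X$ is $\Omega^X(C)=\mathrm{Sub}(X_{|\uparrow C})$. **Formal topologies.** A covering relation on a meet semilattice $L$ is a relation $\vartriangleleft$ between elements and subsets of $L$ such that: (i) $x\in U\Rightarrow x\vartriangleleft U$; (ii) if $x\vartriangleleft U$ and $u\vartriangleleft V$ for all $u\in U$, then $x\vartriangleleft V$; (iii) $x\vartriangleleft U\Rightarrow x\wedge y\vartriangleleft U$; (iv) if $x\vartriangleleft U$ and $x\vartriangleleft V$ then $x\vartriangleleft\{u\wedge v: u\in U,v\in V\}$. Put $\mathcal A U=\{x: x\vartriangleleft U\}$ and $\mathcal F(L,\vartriangleleft)=\{U\subseteq L: x\vartriangleleft U\Rightarrow x\in U\}$, ordered by inclusion. For subsets write $U\vartriangleleft V$ if $u\vartriangleleft V$ for all $u\in U$. A continuous map $g:(M,\vartriangleleft)\to(L,\blacktriangleleft)$ is given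 by a map $g^*$ from $L$ to the subsets of $M$ such that: (1) $\bigcup_{x\in L}g^*(x)=M$; (2) $\{u\wedge v: u\in g^*(x),v\in g^*(y)\}\vartriangleleft g^*(x\wedge y)$; (3) $x\blacktriangleleft U\Rightarrow g^*(x)\vartriangleleft g^*(U):=\bigcup_{u\in U}g^*(u)$. (Two such $g^*$ are identified if their values at each $x$ cover each other.) **The spectrum.** For $C\in\mathcal C(A)$ let $L_C$ be the bounded distributive lattice freely generated by symbols $D_c$, $c\in C_{\mathrm{sa}}$, subject to $D_1=\top$, $D_a\wedge D_{-a}=\bot$, $D_{-b^2}=\bot$, $D_{a+b}\le D_a\vee D_b$ and $D_{ab}=(D_a\wedge D_b)\vee(D_{-a}\wedge D_{-b})$. Let $\underline L$ be the functor $C\mapsto L_C$, with $L_C\to L_D$, $D_c\mapsto D_c$, for $C\subseteq D$. Write $y\ll x$ if there is $z$ with $y\wedge z=\bot$ and $x\vee z=\top$. A regular ideal is an ideal $V$ such that $x\in V$ whenever every $y\ll x$ lies in $V$. With $f(x)=\{c:\forall b\,(b\ll c\Rightarrow b\le x)\}$, define $x\vartriangleleft U$ on $\underline L$ to mean that $f(x)\le\bigvee_{u\in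 U}f(u)$ in the frame of regular ideals. Put $\mathcal O(\underline\Sigma)=\mathcal F(\underline L,\vartriangleleft)$. **The interval domain.** Let $\mathbb Q\times_<\mathbb Q$ be the meet semilattice of rational pairs $(p,q)$, $p<q$, ordered by inclusion of intervals, with a bottom element $\bot$ added, regarded as a constant functor. Let $\bot\blacktriangleleft U$ for all $U$, and let $(p,q)\blacktriangleleft U$ mean that for all rationals $p<p'<q'<q$ there is $(p'',q'')\in U$ with $(p',q')\le(p'',q'')$. Put $\mathcal O(\underline{\mathbb{IR}})=\mathcal F(\mathbb Q\times_<\mathbb Q,\blacktriangleleft)$. **Statement.** Let $a\in A_{\mathrm{sa}}$. Define $\underline d(a)^*:\mathbb Q\times_<\mathbb Q\to\Omega^{\underline L}$ by $$\underline d(a)^*_C(r,s)(D)=\{D_{f-r}\wedge D_{s-g}: f,g\in D_{\mathrm{sa}},\ f\le a\le g\}\qquad(C\subseteq D,\ r<s),$$ and $\underline d(a)^*_C(\bot)(D)=\{\bot\}$. Then, in $\mathcal T(A)$: 1. $\vartriangleleft$ and $\blacktriangleleft$ are covering relations, and $\underline d(a)^*$ defines a continuous map $\underline d(a):(\underline L,\vartriangleleft)\to(\mathbb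 Q\times_<\mathbb Q,\blacktriangleleft)$ of formal topologies. 2. Hence it induces the Daseinisation frame map: $\mathcal O(\underline{\mathbb{IR}})$ and $\mathcal O(\underline\Sigma)$ are internal frames, and $U\mapsto\mathcal A\,\underline d(a)^*(U)$ is an internal frame map $\mathcal O(\underline{\mathbb{IR}})\to\mathcal O(\underline\Sigma)$ (a natural transformation preserving $\top$, binary meets and all internal suprema). -/

import Mathlib

open CategoryTheory

universe u

/-! ## The functor topos `Sets^P` over a poset, and its power objects

Objects of the topos are functors `P ⥤ Type u`, arrows are natural transformations.  Statements of
the internal language are written out by the Kripke-Joyal clauses for functor topoi: a formula is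
forced at a stage `p`, and `∀` and `⇒` quantify over all later stages `q ≥ p`. -/

namespace FunctorTopos

variable {P : Type u} [PartialOrder P]

/-- The transition map `L(p) → L(q)` for `p ≤ q`. -/
def res (L : P ⥤ Type u) {p q : P} (h : p ≤ q) (x : L.obj p) : L.obj q :=
  L.map (homOfLE h) x

theorem res_refl (L : P ⥤ Type u) {p : P} (h : p ≤ p) (x : L.obj p) : res L h x = x := by
  exact ConcreteCategory.congr_hom (L.map_id p) x

theorem res_res (L : P ⥤ Type u) {p q r : P} (h : p ≤ q) (h' : q ≤ r) (x : L.obj p) :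
    res L h' (res L h x) = res L (h.trans h') x := by
  exact (ConcreteCategory.congr_hom (L.map_comp (homOfLE h) (homOfLE h')) x).symm

/-- The inclusion of `↑p = {q | p ≤ q}` into `P`. -/
def upIncl (p : P) : Set.Ici p ⥤ P where
  obj q := q.1
  map i := homOfLE (leOfHom i)

/-- `Sub(L|↑p)`, the subfunctors of the restriction of `L` to `↑p`. -/
abbrev Sub (L : P ⥤ Type u) (p : P) : Type u := Subfunctor (upIncl p ⋙ L)

/-- The subset `U(q) ⊆ L(q)` for `U ∈ Sub(L|↑p)` and `q ≥ p`. -/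
def Sub.stage {L : P ⥤ Type u} {p : P} (U : Sub L p) (q : P) (h : p ≤ q) : Set (L.obj q) :=
  U.obj ⟨q, h⟩

theorem Sub.res_mem {L : P ⥤ Type u} {p : P} (U : Sub L p) {q r : P} (h : p ≤ q) (h' : q ≤ r)
    {x : L.obj q} (hx : x ∈ U.stage q h) : res L h' x ∈ U.stage r (h.trans h') :=
  U.map (U := ⟨q, h⟩) (V := ⟨r, h.trans h'⟩) (homOfLE h') hx

/-- A family of subsets `s(q) ⊆ L(q)`, `q ≥ p`, stable under the transition maps. -/
def Sub.ofStages {L : P ⥤ Type u} {p : P} (s : ∀ q, p ≤ q → Set (L.obj q))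
    (hs : ∀ (q r : P) (h : p ≤ q) (h' : q ≤ r) (x : L.obj q),
      x ∈ s q h → res L h' x ∈ s r (h.trans h')) : Sub L p where
  obj q := s q.1 q.2
  map {q r} i x hx := hs q.1 r.1 q.2 (leOfHom i) x hx

/-- Truncation of `U ∈ Sub(L|↑p)` to `↑q`. -/
def Sub.restrict {L : P ⥤ Type u} {p q : P} (U : Sub L p) (h : p ≤ q) : Sub L q :=
  Sub.ofStages (fun r h' => U.stage r (h.trans h'))
    (fun _ _ h₁ h₂ _ hx => U.res_mem (h.trans h₁) h₂ hx)

/-- The power object `Ω^L : p ↦ Sub(L|↑p)`, with truncation as transition maps. -/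
def power (L : P ⥤ Type u) : P ⥤ Type u where
  obj p := Sub L p
  map i := TypeCat.ofHom fun U => U.restrict (leOfHom i)
  map_id _ := rfl
  map_comp _ _ := rfl

/-- Two elements of `Sub(L|↑p)` agree if they agree at all stages. -/
theorem Sub.ext_stage {L : P ⥤ Type u} {p : P} {U V : Sub L p}
    (h : ∀ q hq, U.stage q hq = V.stage q hq) : U = V :=
  Subfunctor.ext (funext fun q => h q.1 q.2)

/-! ## Internal meet semilattices and distributive lattices -/

/-- An internal meet semilattice: a functor from `P` to meet semilattices. -/
class InternalMeetSemilattice (L : P ⥤ Type u) where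
  semilattice : ∀ p, SemilatticeInf (L.obj p)
  res_inf : ∀ {p q : P} (h : p ≤ q) (x y : L.obj p),
    res L h (x ⊓ y) = res L h x ⊓ res L h y

attribute [reducible, instance] InternalMeetSemilattice.semilattice

/-- An internal distributive lattice (with top and bottom): a functor from `P` to such lattices. -/
class InternalDistribLattice (L : P ⥤ Type u) where
  lattice : ∀ p, DistribLattice (L.obj p)
  bounded : ∀ p, BoundedOrder (L.obj p)
  res_inf : ∀ {p q : P} (h : p ≤ q) (x y : L.obj p),
    res L h (x ⊓ y) = res L h x ⊓ res L h y
  res_sup : ∀ {p q : P} (h : p ≤ q) (x y : L.obj p),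
    res L h (x ⊔ y) = res L h x ⊔ res L h y
  res_top : ∀ {p q : P} (h : p ≤ q), res L h (⊤ : L.obj p) = ⊤
  res_bot : ∀ {p q : P} (h : p ≤ q), res L h (⊥ : L.obj p) = ⊥

attribute [reducible, instance] InternalDistribLattice.lattice InternalDistribLattice.bounded

instance (L : P ⥤ Type u) [InternalDistribLattice L] : InternalMeetSemilattice L where
  semilattice _ := inferInstance
  res_inf := InternalDistribLattice.res_inf

/-! ## Internal covering relations (formal topologies) -/

/-- `U ∧ V = {x ∧ y | x ∈ U, y ∈ V}`. -/
def Sub.meet {L : P ⥤ Type u} [InternalMeetSemilattice L] {p : P} (U V : Sub L p) : Sub L p :=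
  Sub.ofStages (fun q h => {z | ∃ x ∈ U.stage q h, ∃ y ∈ V.stage q h, z = x ⊓ y}) (by
    rintro q r h h' _ ⟨x, hx, y, hy, rfl⟩
    exact ⟨_, U.res_mem h h' hx, _, V.res_mem h h' hy, InternalMeetSemilattice.res_inf h' x y⟩)

/-- An internal relation between elements and subsets of `L`: a subobject of `L × Ω^L`. -/
abbrev CoverRel (L : P ⥤ Type u) : Type u := Subfunctor (FunctorToTypes.prod L (power L))

/-- `p ⊩ x ◁ U`. -/
def CoverRel.covers {L : P ⥤ Type u} (c : CoverRel L) {p : P} (x : L.obj p) (U : Sub L p) : Prop :=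
  ((x, U) : L.obj p × Sub L p) ∈ c.obj p

/-- A subobject of `L × Ω^L` given by relations at all stages that persist to later stages. -/
def CoverRel.ofStages {L : P ⥤ Type u} (R : ∀ p, L.obj p → Sub L p → Prop)
    (hR : ∀ (p q : P) (h : p ≤ q) (x : L.obj p) (U : Sub L p),
      R p x U → R q (res L h x) (U.restrict h)) : CoverRel L where
  obj p := {z : L.obj p × Sub L p | R p z.1 z.2}
  map {p q} i z hz := hR p q (leOfHom i) z.1 z.2 hz

/-- `p ⊩ U ◁ V`, i.e. `p ⊩ ∀ y ∈ U, y ◁ V`. -/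
def CoverRel.coversAll {L : P ⥤ Type u} (c : CoverRel L) {p : P} (U V : Sub L p) : Prop :=
  ∀ (q : P) (h : p ≤ q), ∀ y ∈ U.stage q h, c.covers y (V.restrict h)

/-- The axioms of a covering relation on a meet semilattice, interpreted in the topos. -/
structure IsCovering {L : P ⥤ Type u} [InternalMeetSemilattice L] (c : CoverRel L) : Prop where
  refl : ∀ (p : P) (x : L.obj p) (U : Sub L p), x ∈ U.stage p le_rfl → c.covers x U
  trans : ∀ (p : P) (x : L.obj p) (U V : Sub L p), c.covers x U → c.coversAll U V → c.covers x V
  inf_left : ∀ (p : P) (x y : L.obj p) (U : Sub L p), c.covers x U → c.covers (x ⊓ y) U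
  meet : ∀ (p : P) (x : L.obj p) (U V : Sub L p),
    c.covers x U → c.covers x V → c.covers x (U.meet V)

/-- The object `F(L, ◁) = {U ∈ Ω^L | ∀ x, x ◁ U ⇒ x ∈ U}` of the topos. -/
def opens {L : P ⥤ Type u} (c : CoverRel L) : P ⥤ Type u where
  obj p := {U : Sub L p // ∀ (q : P) (h : p ≤ q) (x : L.obj q),
    c.covers x (U.restrict h) → x ∈ U.stage q h}
  map i := TypeCat.ofHom fun U =>
    ⟨U.1.restrict (leOfHom i), fun q h x hx => U.2 q ((leOfHom i).trans h) x hx⟩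
  map_id _ := rfl
  map_comp _ _ := rfl

/-- The subfunctor underlying an element of `F(L, ◁)(p)`. -/
def opens.toSub {L : P ⥤ Type u} {c : CoverRel L} {p : P} (U : (opens c).obj p) : Sub L p :=
  Subtype.val U

/-- `𝒜U = {x | x ◁ U}`. -/
def CoverRel.saturate {L : P ⥤ Type u} (c : CoverRel L) {p : P} (U : Sub L p) : Sub L p :=
  Sub.ofStages (fun q h => {x | c.covers x (U.restrict h)}) (by
    intro q r h h' x hx
    exact c.map (homOfLE h') hx)

/-! ## Continuous maps -/

/-- For an arrow `f : L ⟶ Ω^M`, the subset `f(x)` of `M` assigned to `x ∈ L(p)`. -/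
def valueAt {L M : P ⥤ Type u} (f : L ⟶ power M) {p : P} (x : L.obj p) : Sub M p := f.app p x

theorem valueAt_res {L M : P ⥤ Type u} (f : L ⟶ power M) {p q : P} (h : p ≤ q) (x : L.obj p) :
    valueAt f (res L h x) = (valueAt f x).restrict h :=
  NatTrans.naturality_apply f (homOfLE h) x

/-- `f(U) = ⋃_{u ∈ U} f(u)`. -/
def unionOver {L M : P ⥤ Type u} (f : L ⟶ power M) {p : P} (U : Sub L p) : Sub M p :=
  Sub.ofStages (fun q h => {m | ∃ u ∈ U.stage q h, m ∈ (valueAt f u).stage q le_rfl}) (by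
    rintro q r h h' m ⟨u, hu, hm⟩
    refine ⟨res L h' u, U.res_mem h h' hu, ?_⟩
    rw [valueAt_res]
    exact (valueAt f u).res_mem le_rfl h' hm)

/-- The conditions on `f = g^* : L ⟶ Ω^M` that make it (a representative of) a continuous map
`g : (M, d) → (L, c)` of formal topologies in the topos. -/
structure IsContinuous {L M : P ⥤ Type u} [InternalMeetSemilattice L] [InternalMeetSemilattice M]
    (d : CoverRel M) (c : CoverRel L) (f : L ⟶ power M) : Prop where
  total : ∀ (p : P) (m : M.obj p), ∃ l : L.obj p, m ∈ (valueAt f l).stage p le_rfl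
  inf : ∀ (p : P) (x y : L.obj p),
    d.coversAll ((valueAt f x).meet (valueAt f y)) (valueAt f (x ⊓ y))
  cover : ∀ (p : P) (x : L.obj p) (U : Sub L p),
    c.covers x U → d.coversAll (valueAt f x) (unionOver f U)

/-! ## Internal frames -/

/-- An internal poset: a functor from `P` to posets. -/
class InternalPoset (F : P ⥤ Type u) where
  order : ∀ p, PartialOrder (F.obj p)
  res_mono : ∀ {p q : P} (h : p ≤ q) (x y : F.obj p), x ≤ y → res F h x ≤ res F h y

attribute [reducible, instance] InternalPoset.order

/-- `F(L, ◁)` is ordered by inclusion. -/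
instance {L : P ⥤ Type u} (c : CoverRel L) : InternalPoset (opens c) where
  order _ := inferInstanceAs (PartialOrder (Subtype _))
  res_mono {_ _} h _ _ hUV := fun r _ hx => hUV ⟨r.1, h.trans r.2⟩ hx

/-- The direct image of `S ∈ Sub(F|↑p)` under an arrow of the topos. -/
def Sub.image {F G : P ⥤ Type u} (φ : F ⟶ G) {p : P} (S : Sub F p) : Sub G p :=
  Sub.ofStages (fun q h => {w | ∃ y ∈ S.stage q h, w = φ.app q y}) (by
    rintro q r h h' _ ⟨y, hy, rfl⟩
    exact ⟨res F h' y, S.res_mem h h' hy, (NatTrans.naturality_apply φ (homOfLE h') y).symm⟩)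

section frames

variable {F G : P ⥤ Type u} [InternalPoset F] [InternalPoset G]

/-- `p ⊩ t = ⊤`. -/
def IsTopAt {p : P} (t : F.obj p) : Prop :=
  ∀ (q : P) (h : p ≤ q) (x : F.obj q), x ≤ res F h t

/-- `p ⊩ z = x ∧ y`. -/
def IsInfAt {p : P} (x y z : F.obj p) : Prop :=
  ∀ (q : P) (h : p ≤ q) (w : F.obj q), w ≤ res F h z ↔ w ≤ res F h x ∧ w ≤ res F h y

/-- `p ⊩ z` is an upper bound of `S`. -/
def IsUpperBoundAt {p : P} (S : Sub F p) (z : F.obj p) : Prop :=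
  ∀ (q : P) (h : p ≤ q), ∀ x ∈ S.stage q h, x ≤ res F h z

/-- `p ⊩ z = ⋁ S`. -/
def IsSupAt {p : P} (S : Sub F p) (z : F.obj p) : Prop :=
  IsUpperBoundAt S z ∧
    ∀ (q : P) (h : p ≤ q) (w : F.obj q), IsUpperBoundAt (S.restrict h) w → res F h z ≤ w

theorem IsInfAt.res {p q : P} (h : p ≤ q) {x y z : F.obj p} (hz : IsInfAt x y z) :
    IsInfAt (res F h x) (res F h y) (res F h z) := by
  intro r h' w
  simp only [res_res]
  exact hz r (h.trans h') w

/-- The subset `{x ∧ y | y ∈ S}`. -/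
def infImage {p : P} (x : F.obj p) (S : Sub F p) : Sub F p :=
  Sub.ofStages (fun q h => {w | ∃ y ∈ S.stage q h, IsInfAt (res F h x) y w}) (by
    rintro q r h h' w ⟨y, hy, hw⟩
    refine ⟨res F h' y, S.res_mem h h' hy, ?_⟩
    rw [← res_res F h h' x]
    exact hw.res h')

variable (F) in
/-- `F` is an internal frame: it has a top, binary meets, suprema of all (internal) subsets, and
binary meets distribute over these suprema. -/
structure IsInternalFrame : Prop where
  top : ∀ p, ∃ t : F.obj p, IsTopAt t
  inf : ∀ (p : P) (x y : F.obj p), ∃ z, IsInfAt x y z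
  sup : ∀ (p : P) (S : Sub F p), ∃ z, IsSupAt S z
  distrib : ∀ (p : P) (x s z : F.obj p) (S : Sub F p),
    IsSupAt S s → IsInfAt x s z → IsSupAt (infImage x S) z

/-- `φ` is an internal frame map: it preserves the top, binary meets and arbitrary suprema. -/
structure IsFrameMap (φ : F ⟶ G) : Prop where
  top : ∀ (p : P) (t : F.obj p), IsTopAt t → IsTopAt (φ.app p t : G.obj p)
  inf : ∀ (p : P) (x y z : F.obj p), IsInfAt x y z →
    IsInfAt (φ.app p x : G.obj p) (φ.app p y : G.obj p) (φ.app p z : G.obj p)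
  sup : ∀ (p : P) (S : Sub F p) (z : F.obj p), IsSupAt S z →
    IsSupAt (S.image φ) (φ.app p z : G.obj p)

end frames

/-! ## The covering relation that a distributive lattice carries through its regular ideals -/

/-- `x ≪ y` iff there is `z` with `x ∧ z = ⊥` and `y ∨ z = ⊤`. -/
def WellInside {X : Type u} [DistribLattice X] [BoundedOrder X] (x y : X) : Prop :=
  ∃ z, x ⊓ z = ⊥ ∧ y ⊔ z = ⊤

section regular

variable {L : P ⥤ Type u} [InternalDistribLattice L]

/-- `p ⊩ V` is a regular ideal of `L`: an ideal such that `(∀ y, y ≪ x ⇒ y ∈ V) ⇒ x ∈ V`. -/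
structure IsRegularIdealAt {p : P} (V : Sub L p) : Prop where
  bot_mem : ∀ (q : P) (h : p ≤ q), ⊥ ∈ V.stage q h
  lower : ∀ (q : P) (h : p ≤ q) (x y : L.obj q), x ∈ V.stage q h → y ≤ x → y ∈ V.stage q h
  sup_mem : ∀ (q : P) (h : p ≤ q) (x y : L.obj q),
    x ∈ V.stage q h → y ∈ V.stage q h → x ⊔ y ∈ V.stage q h
  regular : ∀ (q : P) (h : p ≤ q) (x : L.obj q),
    (∀ (r : P) (h' : q ≤ r) (y : L.obj r),
      WellInside y (res L h' x) → y ∈ V.stage r (h.trans h')) → x ∈ V.stage q h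

/-- The canonical map from `L` to its regular ideals, `f(x) = {c | ∀ b, b ≪ c ⇒ b ≤ x}`. -/
def canon {p : P} (x : L.obj p) : Sub L p :=
  Sub.ofStages (fun q h => {c | ∀ (r : P) (h' : q ≤ r) (b : L.obj r),
      WellInside b (res L h' c) → b ≤ res L (h.trans h') x}) (by
    intro q r h h' c hc s h'' b hb
    rw [res_res] at hb
    exact hc s (h'.trans h'') b hb)

variable (L) in
/-- `x ◁ U` iff `f(x) ≤ ⋁ f(U)` in the frame of regular ideals of `L`; as `⋁ f(U)` is the least
regular ideal that contains all `f(u)`, `u ∈ U`, this says that every regular ideal that contains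
all of these contains `f(x)`. -/
def regularCover : CoverRel L :=
  CoverRel.ofStages
    (fun p x U => ∀ (q : P) (h : p ≤ q) (V : Sub L q), IsRegularIdealAt V →
      (∀ (r : P) (h' : q ≤ r), ∀ u ∈ U.stage r (h.trans h'), canon u ≤ V.restrict h') →
      canon (res L h x) ≤ V)
    (by
      intro p q h x U hx r h' V hV hU
      rw [res_res]
      exact hx r (h.trans h') V hV hU)

end regular

end FunctorTopos

open FunctorTopos

/-! ## The interval domain -/

/-- The underlying set of `ℚ ×_< ℚ`: rational pairs `(p, q)` with `p < q`, and a bottom element. -/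
inductive RatInterval : Type u where
  | bot : RatInterval
  | mk (p q : ℚ) (h : p < q) : RatInterval

namespace RatInterval

/-- Inclusion of intervals; `⊥` is below everything. -/
def le : RatInterval.{u} → RatInterval.{u} → Prop
  | bot, _ => True
  | mk _ _ _, bot => False
  | mk p q _, mk p' q' _ => p' ≤ p ∧ q ≤ q'

/-- Intersection of intervals, `⊥` if it is empty. -/
def inf : RatInterval.{u} → RatInterval.{u} → RatInterval.{u}
  | bot, _ => bot
  | mk _ _ _, bot => bot
  | mk p q _, mk p' q' _ => if h : max p p' < min q q' then mk (max p p') (min q q') h else bot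

instance : SemilatticeInf RatInterval.{u} where
  le := le
  le_refl x := by cases x <;> simp [le]
  le_trans x y z hxy hyz := by
    cases x <;> cases y <;> cases z <;> simp only [le] at * <;> grind
  le_antisymm x y hxy hyx := by
    cases x <;> cases y <;> simp only [le, mk.injEq] at * <;> grind
  inf := inf
  inf_le_left x y := by
    cases x <;> cases y <;> simp only [inf, le]
    split <;> grind [le]
  inf_le_right x y := by
    cases x <;> cases y <;> simp only [inf, le]
    split <;> grind [le]
  le_inf x y z hxy hxz := by
    cases x <;> cases y <;> cases z <;> simp only [inf, le] at *
    split <;> grind [le]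

end RatInterval

section intervals

variable (P : Type u) [PartialOrder P]

/-- The constant functor `ℚ ×_< ℚ`. -/
def intervalObj : P ⥤ Type u := (Functor.const P).obj RatInterval.{u}

instance : InternalMeetSemilattice (intervalObj P) where
  semilattice _ := inferInstanceAs (SemilatticeInf RatInterval)
  res_inf _ _ _ := rfl

/-- The covering relation of the interval domain: `⊥ ◀ U` always, and `(p, q) ◀ U` iff for all
rationals `p < p' < q' < q` there is `(p'', q'') ∈ U` with `(p', q') ≤ (p'', q'')`. -/
def intervalCover : CoverRel (intervalObj P) :=
  CoverRel.ofStages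
    (fun C x U => ∀ (p q : ℚ) (h : p < q), x = RatInterval.mk p q h →
      ∀ (D : P) (hD : C ≤ D) (p' q' : ℚ) (h' : p' < q'), p < p' → q' < q →
        ∃ (p'' q'' : ℚ) (h'' : p'' < q''), RatInterval.mk p'' q'' h'' ∈ U.stage D hD ∧
          RatInterval.mk.{u} p' q' h' ≤ RatInterval.mk p'' q'' h'')
    (fun _ _ hCD _ _ hR p q h hx D hD => hR p q h hx D (hCD.trans hD))

end intervals

/-! ## Commutative subalgebras and the spectral lattice -/

/-- The poset `𝒞(A)` of unital commutative C*-subalgebras of `A`, ordered by inclusion. -/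
def Context (A : Type u) [CStarAlgebra A] : Type u :=
  {C : StarSubalgebra ℂ A // IsClosed (C : Set A) ∧ ∀ x ∈ C, ∀ y ∈ C, x * y = y * x}

namespace Context

variable {A : Type u} [CStarAlgebra A]

instance : PartialOrder (Context A) := inferInstanceAs (PartialOrder (Subtype _))

/-- The real vector space `C_sa` of self-adjoint elements of `C`. -/
noncomputable def sa (C : Context A) : Submodule ℝ A :=
  C.1.toSubalgebra.toSubmodule.restrictScalars ℝ ⊓ selfAdjoint.submodule ℝ A

theorem mem_sa {C : Context A} {x : A} : x ∈ C.sa ↔ x ∈ C.1 ∧ IsSelfAdjoint x := Iff.rfl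

theorem sa_mono {C D : Context A} (h : C ≤ D) : C.sa ≤ D.sa := fun _ hx => ⟨h hx.1, hx.2⟩

instance (C : Context A) : One C.sa := ⟨⟨1, mem_sa.2 ⟨one_mem C.1, IsSelfAdjoint.one A⟩⟩⟩

instance (C : Context A) : Mul C.sa :=
  ⟨fun x y => ⟨x.1 * y.1, mem_sa.2 ⟨mul_mem x.2.1 y.2.1, by
    have hx : star x.1 = x.1 := (mem_sa.1 x.2).2
    have hy : star y.1 = y.1 := (mem_sa.1 y.2).2
    rw [IsSelfAdjoint, star_mul, hx, hy]
    exact C.2.2 _ y.2.1 _ x.2.1⟩⟩⟩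

/-- The inclusion `C_sa → D_sa` for `C ⊆ D`. -/
def saIncl {C D : Context A} (h : C ≤ D) (c : C.sa) : D.sa := ⟨c.1, sa_mono h c.2⟩

/-- Lattice terms in the formal symbols `D_c`, `c ∈ C_sa`. -/
inductive Term (C : Context A) : Type u where
  | gen : C.sa → Term C
  | top : Term C
  | bot : Term C
  | inf : Term C → Term C → Term C
  | sup : Term C → Term C → Term C

/-- The least preorder on lattice terms that makes them a bounded distributive lattice (modulo
equivalence) in which the generators satisfy `D_1 = ⊤`, `D_a ∧ D_{-a} = ⊥`, `D_{-b²} = ⊥`,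
`D_{a+b} ≤ D_a ∨ D_b` and `D_{ab} = (D_a ∧ D_b) ∨ (D_{-a} ∧ D_{-b})`. -/
inductive TermLE {C : Context A} : Term C → Term C → Prop where
  | refl (x) : TermLE x x
  | trans {x y z} : TermLE x y → TermLE y z → TermLE x z
  | le_top (x) : TermLE x .top
  | bot_le (x) : TermLE .bot x
  | inf_le_left (x y) : TermLE (.inf x y) x
  | inf_le_right (x y) : TermLE (.inf x y) y
  | le_inf {x y z} : TermLE x y → TermLE x z → TermLE x (.inf y z)
  | le_sup_left (x y) : TermLE x (.sup x y)
  | le_sup_right (x y) : TermLE y (.sup x y)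
  | sup_le {x y z} : TermLE x z → TermLE y z → TermLE (.sup x y) z
  | distrib (x y z) : TermLE (.inf x (.sup y z)) (.sup (.inf x y) (.inf x z))
  | one : TermLE .top (.gen 1)
  | neg (a : C.sa) : TermLE (.inf (.gen a) (.gen (-a))) .bot
  | neg_sq (b : C.sa) : TermLE (.gen (-(b * b))) .bot
  | add (a b : C.sa) : TermLE (.gen (a + b)) (.sup (.gen a) (.gen b))
  | mul_le (a b : C.sa) : TermLE (.gen (a * b))
      (.sup (.inf (.gen a) (.gen b)) (.inf (.gen (-a)) (.gen (-b))))
  | le_mul (a b : C.sa) : TermLE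
      (.sup (.inf (.gen a) (.gen b)) (.inf (.gen (-a)) (.gen (-b)))) (.gen (a * b))

instance (C : Context A) : Preorder (Term C) where
  le := TermLE
  le_refl := .refl
  le_trans _ _ _ := .trans

/-- `L_C`: the distributive lattice freely generated by the symbols `D_c`, `c ∈ C_sa`, subject to
the relations above. -/
def SpecLattice (C : Context A) : Type u := Antisymmetrization (Term C) (· ≤ ·)

namespace SpecLattice

variable {C : Context A}

instance : PartialOrder (SpecLattice C) :=
  inferInstanceAs (PartialOrder (Antisymmetrization (Term C) (· ≤ ·)))

/-- The class of a term. -/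
def mk (t : Term C) : SpecLattice C := toAntisymmetrization (· ≤ ·) t

theorem mk_le_mk {s t : Term C} : mk s ≤ mk t ↔ TermLE s t := Iff.rfl

/-- A monotone operation on terms acts on classes. -/
def lift₂ {D : Context A} (op : Term C → Term C → Term D)
    (h : ∀ s s' t t', TermLE s s' → TermLE t t' → TermLE (op s t) (op s' t')) :
    SpecLattice C → SpecLattice C → SpecLattice D :=
  Quotient.map₂ op fun s s' hs t t' ht => ⟨h s s' t t' hs.1 ht.1, h s' s t' t hs.2 ht.2⟩

instance : Lattice (SpecLattice C) where
  inf := lift₂ .inf fun _ _ _ _ hs ht =>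
    .le_inf ((TermLE.inf_le_left _ _).trans hs) ((TermLE.inf_le_right _ _).trans ht)
  sup := lift₂ .sup fun _ _ _ _ hs ht =>
    .sup_le (hs.trans (TermLE.le_sup_left _ _)) (ht.trans (TermLE.le_sup_right _ _))
  inf_le_left := by rintro ⟨_⟩ ⟨_⟩; exact TermLE.inf_le_left _ _
  inf_le_right := by rintro ⟨_⟩ ⟨_⟩; exact TermLE.inf_le_right _ _
  le_inf := by rintro ⟨_⟩ ⟨_⟩ ⟨_⟩; exact TermLE.le_inf
  le_sup_left := by rintro ⟨_⟩ ⟨_⟩; exact TermLE.le_sup_left _ _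
  le_sup_right := by rintro ⟨_⟩ ⟨_⟩; exact TermLE.le_sup_right _ _
  sup_le := by rintro ⟨_⟩ ⟨_⟩ ⟨_⟩; exact TermLE.sup_le

instance : DistribLattice (SpecLattice C) :=
  DistribLattice.ofInfSupLe (by rintro ⟨_⟩ ⟨_⟩ ⟨_⟩; exact TermLE.distrib _ _ _)

instance : BoundedOrder (SpecLattice C) where
  top := mk .top
  le_top := by rintro ⟨_⟩; exact TermLE.le_top _
  bot := mk .bot
  bot_le := by rintro ⟨_⟩; exact TermLE.bot_le _

/-- The generator `D_c` of `L_C`. -/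
def D (c : C.sa) : SpecLattice C := mk (.gen c)

end SpecLattice

/-- Terms over `C` are terms over `D` if `C ⊆ D`. -/
def Term.incl {C D : Context A} (h : C ≤ D) : Term C → Term D
  | .gen c => .gen (saIncl h c)
  | .top => .top
  | .bot => .bot
  | .inf x y => .inf (x.incl h) (y.incl h)
  | .sup x y => .sup (x.incl h) (y.incl h)

theorem TermLE.incl {C D : Context A} (h : C ≤ D) {s t : Term C} (hst : TermLE s t) :
    TermLE (s.incl h) (t.incl h) := by
  induction hst with
  | refl x => exact .refl _
  | trans _ _ h₁ h₂ => exact h₁.trans h₂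
  | le_top x => exact .le_top _
  | bot_le x => exact .bot_le _
  | inf_le_left x y => exact .inf_le_left _ _
  | inf_le_right x y => exact .inf_le_right _ _
  | le_inf _ _ h₁ h₂ => exact .le_inf h₁ h₂
  | le_sup_left x y => exact .le_sup_left _ _
  | le_sup_right x y => exact .le_sup_right _ _
  | sup_le _ _ h₁ h₂ => exact .sup_le h₁ h₂
  | distrib x y z => exact .distrib _ _ _
  | one => exact .one
  | neg a => exact .neg (saIncl h a)
  | neg_sq b => exact .neg_sq (saIncl h b)
  | add a b => exact .add (saIncl h a) (saIncl h b)
  | mul_le a b => exact .mul_le (saIncl h a) (saIncl h b)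
  | le_mul a b => exact .le_mul (saIncl h a) (saIncl h b)

theorem Term.incl_refl {C : Context A} (h : C ≤ C) (t : Term C) : t.incl h = t := by
  induction t with
  | gen c => rfl
  | top => rfl
  | bot => rfl
  | inf x y hx hy => simp only [Term.incl, hx, hy]
  | sup x y hx hy => simp only [Term.incl, hx, hy]

theorem Term.incl_incl {C D E : Context A} (h : C ≤ D) (h' : D ≤ E) (t : Term C) :
    (t.incl h).incl h' = t.incl (h.trans h') := by
  induction t with
  | gen c => rfl
  | top => rfl
  | bot => rfl
  | inf x y hx hy => simp only [Term.incl, hx, hy]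
  | sup x y hx hy => simp only [Term.incl, hx, hy]

/-- The map `L_C → L_D`, `D_c ↦ D_c`, for `C ⊆ D`. -/
def SpecLattice.incl {C D : Context A} (h : C ≤ D) : SpecLattice C → SpecLattice D :=
  Quotient.map (Term.incl h) fun _ _ hst => ⟨TermLE.incl h hst.1, TermLE.incl h hst.2⟩

variable (A) in
/-- The functor `C ↦ L_C`, i.e. the lattice `L` of the Bohrification of `A` in the topos. -/
def specObj : Context A ⥤ Type u where
  obj C := SpecLattice C
  map i := TypeCat.ofHom (SpecLattice.incl (leOfHom i))
  map_id C := by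
    ext ⟨t⟩
    exact congrArg SpecLattice.mk (Term.incl_refl le_rfl t)
  map_comp i j := by
    ext ⟨t⟩
    exact (congrArg SpecLattice.mk (Term.incl_incl (leOfHom i) (leOfHom j) t)).symm

instance : InternalDistribLattice (specObj A) where
  lattice C := inferInstanceAs (DistribLattice (SpecLattice C))
  bounded C := inferInstanceAs (BoundedOrder (SpecLattice C))
  res_inf _ := by rintro ⟨_⟩ ⟨_⟩; rfl
  res_sup _ := by rintro ⟨_⟩ ⟨_⟩; rfl
  res_top _ := rfl
  res_bot _ := rfl

variable (A) in
/-- The covering relation `◁` on the spectral lattice: `F(specObj A, specCover A)` is the (opens of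
the) Gelfand spectrum of the Bohrification of `A`. -/
def specCover : CoverRel (specObj A) := regularCover (specObj A)

/-! ## The map `d(a)` -/

variable [PartialOrder A]

/-- The set `d(a)^*(r, s)(C) = {D_{f-r} ∧ D_{s-g} | f, g ∈ C_sa, f ≤ a ≤ g}`; the bottom element
is sent to `{⊥}`, which is what the formula gives for `s ≤ r`. -/
def daseinSet (a : A) (C : Context A) : RatInterval.{u} → Set (SpecLattice C)
  | .bot => {⊥}
  | .mk r s _ => {x | ∃ f g : C.sa, (f : A) ≤ a ∧ a ≤ (g : A) ∧
      x = SpecLattice.D (f - (r : ℝ) • (1 : C.sa)) ⊓ SpecLattice.D ((s : ℝ) • (1 : C.sa) - g)}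

theorem incl_mem_daseinSet (a : A) {C D : Context A} (h : C ≤ D) (i : RatInterval.{u})
    {x : SpecLattice C} (hx : x ∈ daseinSet a C i) : x.incl h ∈ daseinSet a D i := by
  cases i with
  | bot =>
    cases hx
    exact rfl
  | mk r s hrs =>
    obtain ⟨f, g, hf, hg, rfl⟩ := hx
    exact ⟨saIncl h f, saIncl h g, hf, hg, rfl⟩

/-- The arrow `d(a)^* : ℚ ×_< ℚ ⟶ Ω^L` of the topos. -/
def daseinStar (a : A) : intervalObj (Context A) ⟶ power (specObj A) where
  app C := TypeCat.ofHom fun i => (Sub.ofStages (p := C) (fun E _ => daseinSet a E i)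
    (fun _ _ _ h' _ hx => incl_mem_daseinSet a h' i hx) : Sub (specObj A) C)
  naturality _ _ _ := rfl

end Context

namespace FunctorTopos

variable {P : Type u} [PartialOrder P]

section uniqueness

variable {F : P ⥤ Type u} [InternalPoset F]

theorem IsTopAt.unique {p : P} {s t : F.obj p} (hs : IsTopAt s) (ht : IsTopAt t) : s = t := by
  have h₁ := hs p le_rfl t
  have h₂ := ht p le_rfl s
  rw [res_refl] at h₁ h₂
  exact le_antisymm h₂ h₁

theorem IsInfAt.unique {p : P} {x y z w : F.obj p} (hz : IsInfAt x y z) (hw : IsInfAt x y w) :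
    z = w := by
  have h₁ := hz p le_rfl
  have h₂ := hw p le_rfl
  simp only [res_refl] at h₁ h₂
  exact le_antisymm ((h₂ z).2 ((h₁ z).1 le_rfl)) ((h₁ w).2 ((h₂ w).1 le_rfl))

theorem IsSupAt.unique {p : P} {S : Sub F p} {z w : F.obj p} (hz : IsSupAt S z)
    (hw : IsSupAt S w) : z = w := by
  have h₁ := hz.2 p le_rfl w hw.1
  have h₂ := hw.2 p le_rfl z hz.1
  rw [res_refl] at h₁ h₂
  exact le_antisymm h₁ h₂

end uniqueness

section covering

variable {L : P ⥤ Type u}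

theorem Sub.stage_subset_of_le {p : P} {U V : Sub L p} (h : U ≤ V) (q : P) (hq : p ≤ q) :
    U.stage q hq ⊆ V.stage q hq :=
  h ⟨q, hq⟩

theorem Sub.le_of_stage {p : P} {U V : Sub L p}
    (h : ∀ q hq, U.stage q hq ⊆ V.stage q hq) : U ≤ V :=
  fun q => h q.1 q.2

/-- An element of `F(L, ◁)` contains everything that it covers. -/
theorem opens.mem_of_covers {c : CoverRel L} {p : P} (U : (opens c).obj p) {q : P} (h : p ≤ q)
    {x : L.obj q} (hx : c.covers x ((opens.toSub U).restrict h)) :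
    x ∈ (opens.toSub U).stage q h :=
  U.2 q h x hx

theorem opens.le_iff {c : CoverRel L} {p : P} {U V : (opens c).obj p} :
    U ≤ V ↔ ∀ q (h : p ≤ q), (opens.toSub U).stage q h ⊆ (opens.toSub V).stage q h :=
  ⟨fun h q hq => Sub.stage_subset_of_le h q hq, fun h => Sub.le_of_stage h⟩

theorem CoverRel.coversAll_res {c : CoverRel L} {p q : P} (h : p ≤ q) {U V : Sub L p} (hUV : c.coversAll U V) :
    c.coversAll (U.restrict h) (V.restrict h) :=
  fun r hr y hy => hUV r (h.trans hr) y hy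

/-- The top element of `F(L, ◁)`. -/
def opens.topOpen (c : CoverRel L) (p : P) : (opens c).obj p :=
  ⟨Sub.ofStages (fun _ _ => Set.univ) fun _ _ _ _ _ _ => trivial, fun _ _ _ _ => trivial⟩

theorem opens.isTopAt_topOpen {c : CoverRel L} (p : P) : IsTopAt (opens.topOpen c p) :=
  fun _ _ _ => opens.le_iff.2 fun _ _ _ _ => trivial

/-- The union of a set of elements of `F(L, ◁)`. -/
def opens.union {c : CoverRel L} {p : P} (S : Sub (opens c) p) : Sub L p :=
  Sub.ofStages (fun q h => {x | ∃ U ∈ S.stage q h, x ∈ (opens.toSub U).stage q le_rfl}) (by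
    rintro q r h h' x ⟨U, hU, hx⟩
    exact ⟨res (opens c) h' U, S.res_mem h h' hU, (opens.toSub U).res_mem le_rfl h' hx⟩)

theorem opens.isUpperBoundAt_iff {c : CoverRel L} {p : P} {S : Sub (opens c) p} {W : (opens c).obj p} :
    IsUpperBoundAt S W ↔ ∀ q (h : p ≤ q), (opens.union S).stage q h ⊆ (opens.toSub W).stage q h := by
  constructor
  · rintro hW q h x ⟨U, hU, hx⟩
    exact opens.le_iff.1 (hW q h U hU) q le_rfl hx
  · intro hW q h U hU
    exact opens.le_iff.2 fun r hr x hx =>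
      hW r (h.trans hr) ⟨res (opens c) hr U, S.res_mem h hr hU, hx⟩

variable [InternalMeetSemilattice L] {c : CoverRel L}

namespace IsCovering

theorem covers_of_subset (hc : IsCovering c) {p : P} {x : L.obj p} {U V : Sub L p}
    (hx : c.covers x U) (hUV : ∀ q (h : p ≤ q), U.stage q h ⊆ V.stage q h) : c.covers x V :=
  hc.trans p x U V hx fun q h _ hy => hc.refl q _ (V.restrict h) (hUV q h hy)

theorem covers_of_le (hc : IsCovering c) {p : P} {x y : L.obj p} {U : Sub L p}
    (hy : c.covers y U) (hxy : x ≤ y) : c.covers x U := by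
  have := hc.inf_left p y x U hy
  rwa [inf_eq_right.2 hxy] at this

theorem mem_of_le (hc : IsCovering c) {p : P} (U : (opens c).obj p) {q : P} (h : p ≤ q)
    {x y : L.obj q} (hy : y ∈ (opens.toSub U).stage q h) (hxy : x ≤ y) :
    x ∈ (opens.toSub U).stage q h :=
  opens.mem_of_covers U h (hc.covers_of_le (hc.refl q y ((opens.toSub U).restrict h) hy) hxy)

/-- The element `𝒜U` of `F(L, ◁)`. -/
def closure (hc : IsCovering c) {p : P} (U : Sub L p) : (opens c).obj p :=
  ⟨c.saturate U, fun q h x hx => hc.trans q x _ (U.restrict h) hx fun _ _ _ hy => hy⟩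

theorem closure_le (hc : IsCovering c) {p : P} {U : Sub L p} {V : (opens c).obj p}
    (h : ∀ q (hq : p ≤ q), U.stage q hq ⊆ (opens.toSub V).stage q hq) : hc.closure U ≤ V :=
  opens.le_iff.2 fun _ hq _ hx => opens.mem_of_covers V hq
    (hc.covers_of_subset hx fun r hr => h r (hq.trans hr))

theorem subset_closure (hc : IsCovering c) {p : P} (U : Sub L p) {q : P} (h : p ≤ q) :
    U.stage q h ⊆ (opens.toSub (hc.closure U)).stage q h :=
  fun x hx => hc.refl q x (U.restrict h) hx

/-- The intersection of two elements of `F(L, ◁)`. -/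
def infOpen (hc : IsCovering c) {p : P} (U V : (opens c).obj p) : (opens c).obj p :=
  ⟨Sub.ofStages (fun q h => (opens.toSub U).stage q h ∩ (opens.toSub V).stage q h)
      fun _ _ h h' _ hx => ⟨(opens.toSub U).res_mem h h' hx.1, (opens.toSub V).res_mem h h' hx.2⟩,
    fun _ h _ hx => ⟨opens.mem_of_covers U h (hc.covers_of_subset hx fun _ _ _ hy => hy.1),
      opens.mem_of_covers V h (hc.covers_of_subset hx fun _ _ _ hy => hy.2)⟩⟩

theorem isInfAt_infOpen (hc : IsCovering c) {p : P} (U V : (opens c).obj p) :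
    IsInfAt U V (hc.infOpen U V) := by
  intro q h W
  constructor
  · intro hW
    rw [opens.le_iff] at hW
    exact ⟨opens.le_iff.2 fun r hr x hx => (hW r hr hx).1,
      opens.le_iff.2 fun r hr x hx => (hW r hr hx).2⟩
  · rintro ⟨hU, hV⟩
    rw [opens.le_iff] at hU hV
    exact opens.le_iff.2 fun r hr x hx => ⟨hU r hr hx, hV r hr hx⟩

end IsCovering

theorem IsCovering.isSupAt_closure (hc : IsCovering c) {p : P} (S : Sub (opens c) p) :
    IsSupAt S (hc.closure (opens.union S)) := by
  refine ⟨opens.isUpperBoundAt_iff.2 fun q h => hc.subset_closure _ h, fun q h W hW => ?_⟩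
  exact hc.closure_le (U := (opens.union S).restrict h) (opens.isUpperBoundAt_iff.1 hW)

/-- The opens of a formal topology form a frame. -/
theorem IsCovering.isInternalFrame (hc : IsCovering c) : IsInternalFrame (opens c) where
  top p := ⟨_, opens.isTopAt_topOpen p⟩
  inf p U V := ⟨_, hc.isInfAt_infOpen U V⟩
  sup p S := ⟨_, hc.isSupAt_closure S⟩
  distrib p X s z S hs hz := by
    obtain rfl := hs.unique (hc.isSupAt_closure S)
    obtain rfl := hz.unique (hc.isInfAt_infOpen X _)
    constructor
    · rintro q h W ⟨U, hU, hW⟩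
      obtain rfl := hW.unique (hc.isInfAt_infOpen _ U)
      refine opens.le_iff.2 fun r hr x hx => ⟨hx.1, hc.subset_closure _ (h.trans hr) ?_⟩
      exact ⟨res (opens c) hr U, S.res_mem h hr hU, hx.2⟩
    · intro q h W hW
      refine opens.le_iff.2 fun r hr x hx => opens.mem_of_covers W hr ?_
      have hX : c.covers x ((opens.toSub X).restrict (h.trans hr)) := hc.refl r x _ hx.1
      refine hc.covers_of_subset (hc.meet r x _ _ hX hx.2) ?_
      rintro t ht _ ⟨y, hy, y', ⟨U, hU, hy'⟩, rfl⟩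
      refine opens.isUpperBoundAt_iff.1 hW t (hr.trans ht)
        ⟨hc.infOpen (res (opens c) ((h.trans hr).trans ht) X) U,
          ⟨U, hU, ?_⟩, ?_⟩
      · simpa only [res_res] using hc.isInfAt_infOpen (res (opens c) ((h.trans hr).trans ht) X) U
      · exact ⟨hc.mem_of_le X _ hy inf_le_left, hc.mem_of_le U le_rfl hy' inf_le_right⟩

end covering

section continuous

variable {L M : P ⥤ Type u} [InternalMeetSemilattice L] [InternalMeetSemilattice M]
  {d : CoverRel M} {c : CoverRel L} {f : L ⟶ power M}

/-- The arrow `U ↦ 𝒜 f(U)` from the opens of `L` to the opens of `M`. -/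
def inducedMap (hd : IsCovering d) (c : CoverRel L) (f : L ⟶ power M) : opens c ⟶ opens d where
  app _ := TypeCat.ofHom fun U => hd.closure (unionOver f (opens.toSub U))
  naturality _ _ _ := rfl

theorem IsContinuous.unionOver_meet (hf : IsContinuous d c f) (hd : IsCovering d)
    (hc : IsCovering c) {p : P} (U V : (opens c).obj p) :
    d.coversAll ((unionOver f (opens.toSub U)).meet (unionOver f (opens.toSub V)))
      (unionOver f (opens.toSub (hc.infOpen U V))) := by
  rintro q h _ ⟨m, ⟨x, hx, hm⟩, n, ⟨y, hy, hn⟩, rfl⟩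
  refine hd.covers_of_subset (hf.inf q x y q le_rfl _ ⟨m, hm, n, hn, rfl⟩) fun r hr k hk => ?_
  refine ⟨res L hr (x ⊓ y), Sub.res_mem _ h hr
    ⟨hc.mem_of_le U h hx inf_le_left, hc.mem_of_le V h hy inf_le_right⟩, ?_⟩
  rw [valueAt_res]
  exact hk

/-- A continuous map of formal topologies induces a frame map on opens. -/
theorem IsContinuous.isFrameMap (hf : IsContinuous d c f) (hd : IsCovering d) (hc : IsCovering c) :
    IsFrameMap (inducedMap hd c f) where
  top p t ht := by
    obtain rfl := ht.unique (opens.isTopAt_topOpen p)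
    refine fun q h W => opens.le_iff.2 fun r hr m _ => ?_
    obtain ⟨l, hl⟩ := hf.total r m
    exact hd.subset_closure _ (h.trans hr) ⟨l, trivial, hl⟩
  inf p U V Z hZ := by
    obtain rfl := hZ.unique (hc.isInfAt_infOpen U V)
    convert hd.isInfAt_infOpen _ _
    refine le_antisymm (opens.le_iff.2 fun q h m hm => ⟨?_, ?_⟩)
      (opens.le_iff.2 fun q h m hm => ?_)
    · exact hd.covers_of_subset hm fun r hr k ⟨u, hu, hk⟩ => ⟨u, hu.1, hk⟩
    · exact hd.covers_of_subset hm fun r hr k ⟨u, hu, hk⟩ => ⟨u, hu.2, hk⟩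
    · exact hd.trans q m _ _ (hd.meet q m _ _ hm.1 hm.2)
        (CoverRel.coversAll_res h (hf.unionOver_meet hd hc U V))
  sup p S Z hZ := by
    obtain rfl := hZ.unique (hc.isSupAt_closure S)
    convert hd.isSupAt_closure _
    refine le_antisymm (hd.closure_le ?_) (hd.closure_le ?_)
    · rintro q h m ⟨x, hx, hm⟩
      refine hd.trans q m (unionOver f ((opens.union S).restrict h)) _ ?_ ?_
      · have := hf.cover q x _ hx q le_rfl m hm
        exact this
      · rintro r hr n ⟨y, ⟨U, hU, hy⟩, hn⟩
        refine hd.refl r n _ ⟨_, ⟨U, hU, rfl⟩, ?_⟩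
        exact hd.subset_closure _ le_rfl ⟨y, hy, hn⟩
    · rintro q h m ⟨_, ⟨U, hU, rfl⟩, hm⟩
      refine hd.covers_of_subset hm ?_
      rintro r hr n ⟨y, hy, hn⟩
      refine ⟨y, hc.subset_closure _ (h.trans hr) ?_, hn⟩
      exact ⟨res (opens c) hr U, S.res_mem h hr hU, hy⟩

end continuous

section regular

variable {L : P ⥤ Type u} [InternalDistribLattice L]

theorem WellInside.le {X : Type u} [DistribLattice X] [BoundedOrder X] {x y : X}
    (h : WellInside x y) : x ≤ y := by
  obtain ⟨z, hx, hy⟩ := h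
  calc x = x ⊓ (y ⊔ z) := by rw [hy, inf_top_eq]
    _ = x ⊓ y := by rw [inf_sup_left, hx, sup_bot_eq]
    _ ≤ y := inf_le_right

theorem WellInside.mono {X : Type u} [DistribLattice X] [BoundedOrder X] {x x' y y' : X}
    (h : WellInside x y) (hx : x' ≤ x) (hy : y ≤ y') : WellInside x' y' := by
  obtain ⟨z, hxz, hyz⟩ := h
  exact ⟨z, le_bot_iff.1 (hxz ▸ inf_le_inf_right z hx), top_le_iff.1 (hyz ▸ sup_le_sup_right hy z)⟩

theorem res_mono {p q : P} (h : p ≤ q) {x y : L.obj p} (hxy : x ≤ y) :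
    res L h x ≤ res L h y := by
  rw [← inf_eq_left] at hxy ⊢
  rw [← InternalDistribLattice.res_inf, hxy]

theorem mem_canon_of_le {p : P} {x : L.obj p} {q : P} {h : p ≤ q} {y : L.obj q}
    (hy : y ≤ res L h x) : y ∈ (canon x).stage q h := by
  intro r h' b hb
  rw [← res_res L h h']
  exact hb.le.trans (res_mono h' hy)

theorem canon_mono {p : P} {x y : L.obj p} (hxy : x ≤ y) : canon x ≤ canon y :=
  Sub.le_of_stage fun _ h _ hz r h' b hb => (hz r h' b hb).trans (res_mono (h.trans h') hxy)

theorem canon_res {p q : P} (h : p ≤ q) (x : L.obj p) :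
    canon (res L h x) = (canon x).restrict h := by
  refine Sub.ext_stage fun r hr => Set.ext fun y => ?_
  change (∀ _, _) ↔ (∀ _, _)
  simp only [res_res]

theorem canon_stage_lower {p : P} (x : L.obj p) {q : P} (h : p ≤ q) {y z : L.obj q}
    (hy : y ∈ (canon x).stage q h) (hzy : z ≤ y) : z ∈ (canon x).stage q h :=
  fun r h' b hb => hy r h' b (hb.mono le_rfl (res_mono h' hzy))

theorem mem_canon_inf {p : P} {x y : L.obj p} {q : P} {h : p ≤ q} {z : L.obj q}
    (hx : z ∈ (canon x).stage q h) (hy : z ∈ (canon y).stage q h) :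
    z ∈ (canon (x ⊓ y)).stage q h := by
  intro r h' b hb
  rw [InternalDistribLattice.res_inf]
  exact le_inf (hx r h' b hb) (hy r h' b hb)

/-- The set of those `y` with `y ∧ z ∈ V` for all `z ∈ U`. -/
def impl {p : P} (U V : Sub L p) : Sub L p :=
  Sub.ofStages (fun q h => {y | ∀ (r : P) (h' : q ≤ r), ∀ z ∈ U.stage r (h.trans h'),
      res L h' y ⊓ z ∈ V.stage r (h.trans h')}) (by
    intro q r h h' y hy s h'' z hz
    rw [res_res]
    exact hy s (h'.trans h'') z hz)

theorem IsRegularIdealAt.restrict {p q : P} (h : p ≤ q) {V : Sub L p} (hV : IsRegularIdealAt V) :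
    IsRegularIdealAt (V.restrict h) where
  bot_mem r hr := hV.bot_mem r (h.trans hr)
  lower r hr := hV.lower r (h.trans hr)
  sup_mem r hr := hV.sup_mem r (h.trans hr)
  regular r hr := hV.regular r (h.trans hr)

theorem IsRegularIdealAt.impl {p : P} (U : Sub L p) {V : Sub L p} (hV : IsRegularIdealAt V) :
    IsRegularIdealAt (impl U V) where
  bot_mem q h r h' z _ := by
    rw [InternalDistribLattice.res_bot, bot_inf_eq]
    exact hV.bot_mem r _
  lower q h x y hx hyx r h' z hz :=
    hV.lower r _ _ _ (hx r h' z hz) (inf_le_inf_right z (res_mono h' hyx))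
  sup_mem q h x y hx hy r h' z hz := by
    rw [InternalDistribLattice.res_sup, inf_sup_right]
    exact hV.sup_mem r _ _ _ (hx r h' z hz) (hy r h' z hz)
  regular q h x hx r h' z hz := by
    refine hV.regular r _ _ fun s h'' y hy => ?_
    rw [InternalDistribLattice.res_inf, res_res] at hy
    have := hx s (h'.trans h'') y (hy.mono le_rfl inf_le_left) s le_rfl _
      (U.res_mem (h.trans h') h'' hz)
    rwa [res_refl, inf_eq_left.2 (hy.le.trans inf_le_right)] at this

variable (L) in
/-- The covering relation defined through regular ideals makes `L` a formal topology. -/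
theorem isCovering_regularCover : IsCovering (regularCover L) where
  refl p x U hx q h V _ hU := by
    have := hU q le_rfl (res L h x) (U.res_mem le_rfl h hx)
    exact this
  trans p x U V hx hUV q h W hW hV := by
    refine hx q h W hW fun r h' u hu => ?_
    have := hUV r (h.trans h') u hu r le_rfl (W.restrict h') (hW.restrict h')
      fun s hs v hv => hV s (h'.trans hs) v hv
    rwa [res_refl] at this
  inf_left p x y U hx q h V hV hU :=
    (canon_mono (res_mono h inf_le_left)).trans (hx q h V hV hU)
  meet p x U V hU hV q h W hW hUV := by
    have key : ∀ r (h' : q ≤ r), ∀ v ∈ V.stage r (h.trans h'),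
        canon v ≤ (impl (canon (res L h x)) W).restrict h' := by
      intro r h' v hv
      have hx := hU r (h.trans h') (impl (canon v) (W.restrict h')) ((hW.restrict h').impl _) ?_
      · refine Sub.le_of_stage fun s hs z hz t ht y hy => ?_
        have hy' : y ∈ (canon (res L (h.trans h') x)).stage t (hs.trans ht) := by
          rw [← res_res L h h', canon_res]
          exact hy
        have := Sub.stage_subset_of_le hx t (hs.trans ht) hy' t le_rfl _
          ((canon v).res_mem hs ht hz)
        rwa [res_refl, inf_comm] at this
      · intro s hs u hu
        refine Sub.le_of_stage fun t ht z hz k hk y hy => ?_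
        have hmem : res L hs v ⊓ u ∈ (U.meet V).stage s ((h.trans h').trans hs) :=
          ⟨u, hu, res L hs v, V.res_mem (h.trans h') hs hv, inf_comm _ _⟩
        refine Sub.stage_subset_of_le (hUV s (h'.trans hs) _ hmem) k (ht.trans hk) ?_
        refine mem_canon_inf (canon_stage_lower _ _ ?_ inf_le_right)
          (canon_stage_lower _ _ ((canon u).res_mem ht hk hz) inf_le_left)
        rw [canon_res]
        exact hy
    have hx := hV q h _ (hW.impl _) key
    refine Sub.le_of_stage fun r hr z hz => ?_
    have := Sub.stage_subset_of_le hx r hr hz r le_rfl z hz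
    rwa [res_refl, inf_idem] at this

end regular

end FunctorTopos

namespace RatInterval

theorem mk_le_mk {p q p' q' : ℚ} {h : p < q} {h' : p' < q'} :
    mk.{u} p q h ≤ mk p' q' h' ↔ p' ≤ p ∧ q ≤ q' := Iff.rfl

theorem not_mk_le_bot {p q : ℚ} {h : p < q} : ¬ mk.{u} p q h ≤ bot := id

theorem mk_inf_mk {p q p' q' : ℚ} {h : p < q} {h' : p' < q'} :
    mk.{u} p q h ⊓ mk p' q' h' =
      if h : max p p' < min q q' then mk (max p p') (min q q') h else bot := rfl

theorem exists_eq_mk_of_mk_le {p q : ℚ} {h : p < q} {x : RatInterval.{u}} (hx : mk p q h ≤ x) :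
    ∃ (p' q' : ℚ) (h' : p' < q'), x = mk p' q' h' := by
  cases x with
  | bot => exact (not_mk_le_bot hx).elim
  | mk p' q' h' => exact ⟨p', q', h', rfl⟩

end RatInterval

section intervals

open RatInterval

variable (P : Type u) [PartialOrder P]

variable {P} in
theorem covers_intervalCover_iff {p : P} {x : RatInterval.{u}} {U : Sub (intervalObj P) p} :
    (intervalCover P).covers (x : (intervalObj P).obj p) U ↔
      ∀ (r s : ℚ) (h : r < s), x = mk r s h → ∀ (q : P) (hq : p ≤ q) (r' s' : ℚ) (h' : r' < s'),
        r < r' → s' < s → ∃ v : RatInterval.{u}, v ∈ U.stage q hq ∧ mk r' s' h' ≤ v := by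
  constructor
  · intro hx r s h hx' q hq r' s' h' hr hs
    obtain ⟨_, _, _, h₁, h₂⟩ := hx r s h hx' q hq r' s' h' hr hs
    exact ⟨_, h₁, h₂⟩
  · intro hx r s h hx' q hq r' s' h' hr hs
    obtain ⟨v, h₁, h₂⟩ := hx r s h hx' q hq r' s' h' hr hs
    obtain ⟨r'', s'', h'', rfl⟩ := exists_eq_mk_of_mk_le h₂
    exact ⟨_, _, _, h₁, h₂⟩

/-- The interval domain is a formal topology. -/
theorem isCovering_intervalCover : IsCovering (intervalCover P) where
  refl p x U hx := by
    refine covers_intervalCover_iff.2 fun r s h hx' q hq r' s' h' hr hs => ?_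
    subst hx'
    exact ⟨_, U.res_mem le_rfl hq hx, hr.le, hs.le⟩
  trans p x U V hx hUV := by
    refine covers_intervalCover_iff.2 fun r s h hx' q hq r' s' h' hr hs => ?_
    obtain ⟨r₁, hr₁, hr₁'⟩ := exists_between hr
    obtain ⟨s₁, hs₁, hs₁'⟩ := exists_between hs
    obtain ⟨r₂, s₂, h₂, hm, hle⟩ :=
      hx r s h hx' q hq r₁ s₁ (hr₁'.trans (h'.trans hs₁)) hr₁ hs₁'
    exact covers_intervalCover_iff.1 (hUV q hq _ hm) r₂ s₂ h₂ rfl q le_rfl r' s' h'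
      (hle.1.trans_lt hr₁') (hs₁.trans_le hle.2)
  inf_left p x y U hx := by
    refine covers_intervalCover_iff.2 fun r s h hxy q hq r' s' h' hr hs => ?_
    have hle : mk.{u} r s h ≤ x := hxy ▸ (inf_le_left : (x : RatInterval.{u}) ⊓ y ≤ x)
    obtain ⟨r₂, s₂, h₂, rfl⟩ := exists_eq_mk_of_mk_le hle
    exact covers_intervalCover_iff.1 hx r₂ s₂ h₂ rfl q hq r' s' h'
      (hle.1.trans_lt hr) (hs.trans_le hle.2)
  meet p x U V hU hV := by
    refine covers_intervalCover_iff.2 fun r s h hx q hq r' s' h' hr hs => ?_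
    obtain ⟨u, hu, hu'⟩ := covers_intervalCover_iff.1 hU r s h hx q hq r' s' h' hr hs
    obtain ⟨v, hv, hv'⟩ := covers_intervalCover_iff.1 hV r s h hx q hq r' s' h' hr hs
    exact ⟨u ⊓ v, ⟨u, hu, v, hv, rfl⟩, le_inf hu' hv'⟩

end intervals

namespace Context

variable {A : Type u} [CStarAlgebra A] {C : Context A}

theorem coe_sa_mul (x y : C.sa) : ((x * y : C.sa) : A) = x * y := rfl

theorem coe_sa_one : ((1 : C.sa) : A) = 1 := rfl

theorem algebraMap_coe_smul_one (t : ℝ) : ((t • (1 : C.sa) : C.sa) : A) = algebraMap ℝ A t :=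
  (Algebra.algebraMap_eq_smul_one t).symm

theorem isSelfAdjoint_coe (x : C.sa) : IsSelfAdjoint (x : A) := x.2.2

namespace SpecLattice

theorem D_one : D (1 : C.sa) = ⊤ := top_le_iff.1 TermLE.one

theorem D_inf_D_neg (x : C.sa) : D x ⊓ D (-x) = ⊥ := le_bot_iff.1 (TermLE.neg x)

theorem D_neg_mul_self (x : C.sa) : D (-(x * x)) = ⊥ := le_bot_iff.1 (TermLE.neg_sq x)

theorem D_add_le (x y : C.sa) : D (x + y) ≤ D x ⊔ D y := TermLE.add x y

theorem D_mul (x y : C.sa) : D (x * y) = D x ⊓ D y ⊔ D (-x) ⊓ D (-y) :=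
  le_antisymm (TermLE.mul_le x y) (TermLE.le_mul x y)

/-- A property of the generators that is preserved by the lattice operations holds everywhere. -/
theorem induction {p : SpecLattice C → Prop} (hD : ∀ c, p (D c)) (htop : p ⊤) (hbot : p ⊥)
    (hinf : ∀ x y, p x → p y → p (x ⊓ y)) (hsup : ∀ x y, p x → p y → p (x ⊔ y))
    (x : SpecLattice C) : p x := by
  obtain ⟨t⟩ := x
  change p (mk t)
  induction t with
  | gen c => exact hD c
  | top => exact htop
  | bot => exact hbot
  | inf s t hs ht => exact hinf (mk s) (mk t) hs ht
  | sup s t hs ht => exact hsup (mk s) (mk t) hs ht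

end SpecLattice

section characters

/-- The algebra of a context is a commutative C*-algebra. -/
noncomputable instance (C : Context A) : CommCStarAlgebra C.1 where
  __ := @StarSubalgebra.cstarAlgebra _ A _ _ _ _ _ C.1 C.2.1
  mul_comm x y := Subtype.ext (C.2.2 x.1 x.2 y.1 y.2)

/-- The truth value of a lattice term at a character, where `D_c` is read as `φ(c) > 0`. -/
def Term.eval (φ : WeakDual.characterSpace ℂ C.1) : Term C → Prop
  | .gen c => 0 < (φ ⟨c.1, c.2.1⟩).re
  | .top => True
  | .bot => False
  | .inf x y => x.eval φ ∧ y.eval φ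
  | .sup x y => x.eval φ ∨ y.eval φ

theorem im_character (φ : WeakDual.characterSpace ℂ C.1) (c : C.sa) :
    (φ ⟨c.1, c.2.1⟩).im = 0 := by
  have h : IsSelfAdjoint (⟨c.1, c.2.1⟩ : C.1) := Subtype.ext c.2.2
  exact Complex.conj_eq_iff_im.1 ((map_star φ _).symm.trans (congrArg φ h.star_eq))

theorem re_character_mul (φ : WeakDual.characterSpace ℂ C.1) (x y : C.sa) :
    (φ ⟨(x * y).1, (x * y).2.1⟩).re = (φ ⟨x.1, x.2.1⟩).re * (φ ⟨y.1, y.2.1⟩).re := by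
  have : φ ⟨(x * y).1, (x * y).2.1⟩ = φ ⟨x.1, x.2.1⟩ * φ ⟨y.1, y.2.1⟩ :=
    map_mul φ (⟨x.1, x.2.1⟩ : C.1) ⟨y.1, y.2.1⟩
  rw [this, Complex.mul_re, im_character, zero_mul, sub_zero]

theorem re_character_add (φ : WeakDual.characterSpace ℂ C.1) (x y : C.sa) :
    (φ ⟨(x + y).1, (x + y).2.1⟩).re = (φ ⟨x.1, x.2.1⟩).re + (φ ⟨y.1, y.2.1⟩).re := by
  have : φ ⟨(x + y).1, (x + y).2.1⟩ = φ ⟨x.1, x.2.1⟩ + φ ⟨y.1, y.2.1⟩ :=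
    map_add φ (⟨x.1, x.2.1⟩ : C.1) ⟨y.1, y.2.1⟩
  rw [this, Complex.add_re]

theorem re_character_neg (φ : WeakDual.characterSpace ℂ C.1) (x : C.sa) :
    (φ ⟨(-x).1, (-x).2.1⟩).re = -(φ ⟨x.1, x.2.1⟩).re := by
  have : φ ⟨(-x).1, (-x).2.1⟩ = -φ ⟨x.1, x.2.1⟩ := map_neg φ (⟨x.1, x.2.1⟩ : C.1)
  rw [this, Complex.neg_re]

theorem re_character_one (φ : WeakDual.characterSpace ℂ C.1) :
    (φ ⟨(1 : C.sa).1, (1 : C.sa).2.1⟩).re = 1 := by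
  have : φ ⟨(1 : C.sa).1, (1 : C.sa).2.1⟩ = 1 := map_one φ
  rw [this, Complex.one_re]

theorem TermLE.eval (φ : WeakDual.characterSpace ℂ C.1) {s t : Term C} (h : TermLE s t) :
    s.eval φ → t.eval φ := by
  induction h with
  | refl x => exact id
  | trans _ _ h₁ h₂ => exact h₂ ∘ h₁
  | le_top x => exact fun _ => trivial
  | bot_le x => exact False.elim
  | inf_le_left x y => exact And.left
  | inf_le_right x y => exact And.right
  | le_inf _ _ h₁ h₂ => exact fun h => ⟨h₁ h, h₂ h⟩
  | le_sup_left x y => exact Or.inl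
  | le_sup_right x y => exact Or.inr
  | sup_le _ _ h₁ h₂ => exact fun h => h.elim h₁ h₂
  | distrib x y z => exact fun h => h.2.imp (And.intro h.1) (And.intro h.1)
  | one => exact fun _ => by simp only [Term.eval, re_character_one, zero_lt_one]
  | neg a =>
    simp only [Term.eval, re_character_neg]
    exact fun h => by linarith [h.1, h.2]
  | neg_sq b =>
    simp only [Term.eval, re_character_neg, re_character_mul]
    exact fun h => by nlinarith [mul_self_nonneg (φ ⟨b.1, b.2.1⟩).re]
  | add a b =>
    simp only [Term.eval, re_character_add]
    intro h
    by_contra! h'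
    linarith [h'.1, h'.2]
  | mul_le a b =>
    simp only [Term.eval, re_character_neg, re_character_mul, neg_pos]
    exact pos_and_pos_or_neg_and_neg_of_mul_pos
  | le_mul a b =>
    simp only [Term.eval, re_character_neg, re_character_mul, neg_pos]
    exact mul_pos_iff.2

end characters

variable [PartialOrder A] [StarOrderedRing A]

namespace SpecLattice

/-- The spectral lattice knows which elements are bounded away from zero. -/
theorem exists_le_of_D_eq_top {x : C.sa} (hx : D x = ⊤) :
    ∃ ε : ℝ, 0 < ε ∧ algebraMap ℝ A ε ≤ x := by
  cases subsingleton_or_nontrivial A with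
  | inl h => exact ⟨1, one_pos, (Subsingleton.elim _ _).le⟩
  | inr h =>
    refine (CFC.exists_pos_algebraMap_le_iff (isSelfAdjoint_coe x)).2 fun r hr => ?_
    have : IsClosed (C.1 : Set A) := C.2.1
    have hr' : (r : ℂ) ∈ spectrum ℂ (x : A) :=
      spectrum.algebraMap_mem_iff ℂ |>.2 hr
    have hr'' : (r : ℂ) ∈ spectrum ℂ (⟨x.1, x.2.1⟩ : C.1) :=
      (StarSubalgebra.mem_spectrum_iff C.1 (a := ⟨x.1, x.2.1⟩)).2 hr'
    obtain ⟨φ, hφ⟩ := WeakDual.CharacterSpace.mem_spectrum_iff_exists.1 hr''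
    have := TermLE.eval φ (mk_le_mk.1 hx.ge) trivial
    simpa only [Term.eval, hφ, Complex.ofReal_re] using this

theorem exists_mul_self_eq {x : C.sa} (hx : 0 ≤ (x : A)) : ∃ y : C.sa, y * y = x := by
  have : IsClosed (C.1 : Set A) := C.2.1
  have hmem : CFC.sqrt (x : A) ∈ C.1 := by
    rw [CFC.sqrt_eq_real_sqrt _ hx]
    exact cfcₙ_mem _ x.2.1
  exact ⟨⟨CFC.sqrt (x : A), mem_sa.2 ⟨hmem, (CFC.sqrt_nonneg _).isSelfAdjoint⟩⟩,
    Subtype.ext (CFC.sqrt_mul_sqrt_self _ hx)⟩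

theorem D_eq_bot {x : C.sa} (hx : (x : A) ≤ 0) : D x = ⊥ := by
  obtain ⟨y, hy⟩ := exists_mul_self_eq (x := -x) (neg_nonneg.2 hx)
  rw [← neg_neg x, ← hy, D_neg_mul_self]

theorem D_mono {x y : C.sa} (h : (x : A) ≤ y) : D x ≤ D y := by
  have := D_add_le y (x - y)
  rwa [add_sub_cancel, D_eq_bot (x := x - y) (sub_nonpos.2 h), sup_bot_eq] at this

theorem D_mul_of_nonneg {x : C.sa} (hx : 0 ≤ (x : A)) (y : C.sa) : D (x * y) = D x ⊓ D y := by
  rw [D_mul, D_eq_bot (x := -x) (neg_nonpos.2 hx), bot_inf_eq, sup_bot_eq]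

theorem D_sup_of_nonneg {x y : C.sa} (hx : 0 ≤ (x : A)) (hy : 0 ≤ (y : A)) :
    D x ⊔ D y = D (x + y) :=
  le_antisymm (sup_le (D_mono (le_add_of_nonneg_right hy)) (D_mono (le_add_of_nonneg_left hx)))
    (D_add_le x y)

theorem D_zero : D (0 : C.sa) = ⊥ := D_eq_bot le_rfl

theorem D_smul_one {t : ℝ} (ht : 0 < t) : D (t • (1 : C.sa)) = ⊤ := by
  have h : (t • (1 : C.sa)) * (t⁻¹ • (1 : C.sa)) = 1 := Subtype.ext <| by
    rw [coe_sa_mul, algebraMap_coe_smul_one, algebraMap_coe_smul_one, ← map_mul,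
      mul_inv_cancel₀ ht.ne', map_one, coe_sa_one]
  have h₀ : 0 ≤ ((t • (1 : C.sa) : C.sa) : A) := by
    rw [algebraMap_coe_smul_one]
    exact algebraMap_nonneg A ht.le
  have := D_mul_of_nonneg h₀ (t⁻¹ • (1 : C.sa))
  rw [h, D_one] at this
  exact top_le_iff.1 (this.le.trans inf_le_left)

theorem D_eq_top {x : C.sa} {t : ℝ} (ht : 0 < t) (hx : algebraMap ℝ A t ≤ x) : D x = ⊤ :=
  top_le_iff.1 ((D_smul_one ht).ge.trans (D_mono ((algebraMap_coe_smul_one t).le.trans hx)))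

/-- The positive part of an element of `C_sa`. -/
noncomputable def pos (x : C.sa) : C.sa :=
  ⟨(x : A)⁺, mem_sa.2 ⟨by
    have : IsClosed (C.1 : Set A) := C.2.1
    exact cfcₙ_mem _ x.2.1, (CFC.posPart_nonneg _).isSelfAdjoint⟩⟩

theorem pos_nonneg (x : C.sa) : 0 ≤ (pos x : A) := CFC.posPart_nonneg _

theorem le_pos (x : C.sa) : (x : A) ≤ pos x := CFC.le_posPart (isSelfAdjoint_coe x)

theorem pos_sub_pos_neg (x : C.sa) : pos x - pos (-x) = x :=
  Subtype.ext <| (congrArg ((x : A)⁺ - ·) (CFC.posPart_neg (x : A))).trans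
    (CFC.posPart_sub_negPart _ (isSelfAdjoint_coe x))

theorem pos_mul_pos_neg (x : C.sa) : pos x * pos (-x) = 0 :=
  Subtype.ext <| (congrArg ((x : A)⁺ * ·) (CFC.posPart_neg (x : A))).trans
    (CFC.posPart_mul_negPart _)

theorem D_pos_inf_D_pos_neg (x : C.sa) : D (pos x) ⊓ D (pos (-x)) = ⊥ := by
  rw [← D_mul_of_nonneg (pos_nonneg x), pos_mul_pos_neg, D_zero]

/-- Passing to the positive part does not decrease the shifted generators by much. -/
theorem D_le_of_le_pos {x y : C.sa} (hy : D y ≤ D (pos x)) (t : C.sa) (hyt : y = pos x - t) :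
    D y ≤ D (x - t) := by
  have h : y = (x - t) + pos (-x) := by
    rw [hyt]
    nth_rw 2 [← pos_sub_pos_neg x]
    abel
  calc D y ≤ (D (x - t) ⊔ D (pos (-x))) ⊓ D (pos x) := le_inf (h ▸ D_add_le _ _) hy
    _ = D (x - t) ⊓ D (pos x) := by rw [inf_sup_right, inf_comm (D (pos (-x))),
        D_pos_inf_D_pos_neg, sup_bot_eq]
    _ ≤ D (x - t) := inf_le_left

theorem D_pos (x : C.sa) : D (pos x) = D x :=
  le_antisymm (by simpa using D_le_of_le_pos (x := x) (y := pos x) le_rfl 0 (sub_zero _).symm)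
    (D_mono (le_pos x))

theorem D_pos_sub_le (x : C.sa) {ε : ℝ} (hε : 0 ≤ ε) :
    D (pos x - ε • (1 : C.sa)) ≤ D (x - ε • (1 : C.sa)) := by
  refine D_le_of_le_pos (D_mono (sub_le_self _ ?_)) _ rfl
  rw [algebraMap_coe_smul_one]
  exact algebraMap_nonneg A hε

/-- Every element of the spectral lattice is a generator of a positive element. -/
theorem exists_eq_D_nonneg (x : SpecLattice C) : ∃ c : C.sa, 0 ≤ (c : A) ∧ x = D c := by
  induction x using SpecLattice.induction with
  | hD c => exact ⟨pos c, pos_nonneg c, (D_pos c).symm⟩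
  | htop => exact ⟨1, (coe_sa_one (C := C)).symm ▸ zero_le_one, D_one.symm⟩
  | hbot => exact ⟨0, le_rfl, D_zero.symm⟩
  | hinf x y hx hy =>
    obtain ⟨c, hc, rfl⟩ := hx
    obtain ⟨d, hd, rfl⟩ := hy
    refine ⟨c * d, ?_, (D_mul_of_nonneg hc d).symm⟩
    rw [coe_sa_mul]
    exact Commute.mul_nonneg hc hd (C.2.2 _ c.2.1 _ d.2.1)
  | hsup x y hx hy =>
    obtain ⟨c, hc, rfl⟩ := hx
    obtain ⟨d, hd, rfl⟩ := hy
    exact ⟨c + d, add_nonneg hc hd, D_sup_of_nonneg hc hd⟩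

theorem exists_eq_D (x : SpecLattice C) : ∃ c : C.sa, x = D c :=
  (exists_eq_D_nonneg x).imp fun _ h => h.2

/-- If a generator and a further element cover the spectrum, then so do a slightly smaller
generator and this element. -/
theorem exists_D_sub_sup_eq_top {x : C.sa} {z : SpecLattice C} (h : D x ⊔ z = ⊤) :
    ∃ ε : ℝ, 0 < ε ∧ D (x - ε • (1 : C.sa)) ⊔ z = ⊤ := by
  obtain ⟨e, he, rfl⟩ := exists_eq_D_nonneg z
  rw [← D_pos, D_sup_of_nonneg (pos_nonneg x) he] at h
  obtain ⟨δ, hδ, hle⟩ := exists_le_of_D_eq_top h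
  refine ⟨δ / 2, half_pos hδ, top_le_iff.1 ?_⟩
  have htop : D ((pos x - (δ / 2) • (1 : C.sa)) + e) = ⊤ := by
    refine D_eq_top (half_pos hδ) ?_
    have h₁ : (((pos x - (δ / 2) • (1 : C.sa)) + e : C.sa) : A) =
        ((pos x + e : C.sa) : A) - algebraMap ℝ A (δ / 2) := by
      rw [← algebraMap_coe_smul_one (C := C)]
      push_cast
      abel
    rw [h₁, le_sub_iff_add_le, ← map_add, add_halves]
    exact hle
  rw [← htop]
  exact (D_add_le _ _).trans (sup_le_sup_right (D_pos_sub_le x (half_pos hδ).le) _)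

/-- An element well inside a generator is below a slightly smaller generator. -/
theorem exists_wellInside_D_sub {y : SpecLattice C} {x : C.sa} (h : WellInside y (D x)) :
    ∃ ε : ℝ, 0 < ε ∧ WellInside y (D (x - ε • (1 : C.sa))) := by
  obtain ⟨z, hy, hx⟩ := h
  obtain ⟨ε, hε, h⟩ := exists_D_sub_sup_eq_top hx
  exact ⟨ε, hε, z, hy, h⟩

theorem D_sub_mono (x : C.sa) {s t : ℝ} (h : s ≤ t) :
    D (x - t • (1 : C.sa)) ≤ D (x - s • (1 : C.sa)) := by
  refine D_mono (sub_le_sub_left ?_ _)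
  rw [algebraMap_coe_smul_one, algebraMap_coe_smul_one]
  exact algebraMap_mono A h

theorem wellInside_D_sub (x : C.sa) {ε : ℝ} (hε : 0 < ε) :
    WellInside (D (x - ε • (1 : C.sa))) (D x) := by
  refine ⟨D (-(x - ε • (1 : C.sa))), D_inf_D_neg _, top_le_iff.1 ?_⟩
  have := D_add_le x (-(x - ε • (1 : C.sa)))
  rwa [neg_sub, add_sub_cancel, D_smul_one hε, ← neg_sub] at this

/-- The well-inside relation of the spectral lattice interpolates. -/
theorem exists_wellInside_wellInside {x y : SpecLattice C} (h : WellInside x y) :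
    ∃ z, WellInside x z ∧ WellInside z y := by
  obtain ⟨c, rfl⟩ := exists_eq_D y
  obtain ⟨ε, hε, h⟩ := exists_wellInside_D_sub h
  exact ⟨_, h, wellInside_D_sub c hε⟩

end SpecLattice

end Context

namespace Context

variable {A : Type u} [CStarAlgebra A] {C : Context A}

theorem isCovering_specCover : IsCovering (specCover A) := isCovering_regularCover (specObj A)

variable [PartialOrder A]

theorem daseinSet_bot {a : A} {x : SpecLattice C} (h : x ∈ daseinSet a C .bot) : x = ⊥ := h

variable [StarOrderedRing A]

open SpecLattice

/-- To cover an element it suffices to bound, at all later stages, every nonzero element well inside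
it by an element of the cover. -/
theorem specCover_of_wellInside {x : SpecLattice C} {U : Sub (specObj A) C}
    (h : ∀ (E : Context A) (hE : C ≤ E) (y : SpecLattice E), WellInside y (x.incl hE) →
      y ≠ ⊥ → ∃ u, u ∈ U.stage E hE ∧ y ≤ u) : (specCover A).covers x U := by
  intro E hE V hV hU
  refine Sub.le_of_stage fun F hF z hz => hV.regular F hF z fun G hG y hy => ?_
  obtain ⟨w, hyw, hwz⟩ := exists_wellInside_wellInside hy
  have hw : w ≤ x.incl (hE.trans (hF.trans hG)) := by
    have := hz G hG w hwz
    rwa [res_res] at this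
  by_cases hy₀ : y = ⊥
  · exact hy₀ ▸ hV.bot_mem G (hF.trans hG)
  obtain ⟨u, hu, hyu⟩ := h G (hE.trans (hF.trans hG)) y (hyw.mono le_rfl hw) hy₀
  have hcanon := Sub.stage_subset_of_le (hU G (hF.trans hG) u hu) G le_rfl
  exact hcanon (mem_canon_of_le (hyu.trans (res_refl (specObj A) le_rfl u).ge))

theorem exists_mem_daseinSet (a : A) (ha : IsSelfAdjoint a) (x : SpecLattice C) :
    ∃ i, x ∈ daseinSet a C i := by
  obtain ⟨c, rfl⟩ := exists_eq_D x
  obtain ⟨s, hs⟩ := exists_rat_gt ‖a‖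
  obtain ⟨r, hr⟩ := exists_rat_lt (-‖a‖ - ‖(c : A)‖)
  have hrs : r < s := by
    have : (r : ℝ) < s := by linarith [norm_nonneg a, norm_nonneg (c : A)]
    exact_mod_cast this
  refine ⟨.mk r s hrs, c + (r : ℝ) • (1 : C.sa), ‖a‖ • (1 : C.sa), ?_, ?_, ?_⟩
  · have h : ((c + (r : ℝ) • (1 : C.sa) : C.sa) : A) = c + algebraMap ℝ A r := by
      rw [← algebraMap_coe_smul_one (C := C)]
      rfl
    rw [h]
    calc (c : A) + algebraMap ℝ A r ≤ algebraMap ℝ A ‖(c : A)‖ + algebraMap ℝ A r :=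
          add_le_add_left (isSelfAdjoint_coe c).le_algebraMap_norm_self _
      _ = algebraMap ℝ A (‖(c : A)‖ + r) := (map_add _ _ _).symm
      _ ≤ algebraMap ℝ A (-‖a‖) := algebraMap_mono A (by linarith)
      _ = -algebraMap ℝ A ‖a‖ := map_neg _ _
      _ ≤ a := ha.neg_algebraMap_norm_le_self
  · rw [algebraMap_coe_smul_one]
    exact ha.le_algebraMap_norm_self
  · rw [add_sub_cancel_right, ← sub_smul, D_smul_one (sub_pos.2 hs), inf_top_eq]

theorem D_sub_inf_D_sub_eq_bot {f g : C.sa} (hfg : (f : A) ≤ g) {r s : ℝ} (h : s ≤ r) :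
    D (f - r • (1 : C.sa)) ⊓ D (s • (1 : C.sa) - g) = ⊥ := by
  have hle : D (f - r • (1 : C.sa)) ≤ D (g - s • (1 : C.sa)) :=
    (D_sub_mono f h).trans (D_mono (sub_le_sub_right hfg _))
  rw [← neg_sub g, ← le_bot_iff, ← D_inf_D_neg (g - s • (1 : C.sa))]
  exact inf_le_inf_right _ hle

theorem exists_mem_daseinSet_inf {a : A} {i j : RatInterval.{u}} {x y : SpecLattice C}
    (hx : x ∈ daseinSet a C i) (hy : y ∈ daseinSet a C j) :
    ∃ z, z ∈ daseinSet a C (i ⊓ j) ∧ x ⊓ y ≤ z := by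
  cases i with
  | bot =>
    obtain rfl : x = ⊥ := hx
    exact ⟨⊥, rfl, inf_le_left⟩
  | mk r s hrs =>
    cases j with
    | bot =>
      obtain rfl : y = ⊥ := hy
      exact ⟨⊥, rfl, inf_le_right⟩
    | mk r' s' hrs' =>
      obtain ⟨f, g, hf, hg, rfl⟩ := hx
      obtain ⟨f', g', hf', hg', rfl⟩ := hy
      obtain ⟨f₀, hf₀, hle⟩ : ∃ f₀ : C.sa, (f₀ : A) ≤ a ∧
          D (f - (r : ℝ) • (1 : C.sa)) ⊓ D (f' - (r' : ℝ) • (1 : C.sa)) ≤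
            D (f₀ - ((max r r' : ℚ) : ℝ) • (1 : C.sa)) := by
        rcases max_choice r r' with h | h <;> rw [h]
        · exact ⟨f, hf, inf_le_left⟩
        · exact ⟨f', hf', inf_le_right⟩
      obtain ⟨g₀, hg₀, hle'⟩ : ∃ g₀ : C.sa, a ≤ (g₀ : A) ∧
          D ((s : ℝ) • (1 : C.sa) - g) ⊓ D ((s' : ℝ) • (1 : C.sa) - g') ≤
            D (((min s s' : ℚ) : ℝ) • (1 : C.sa) - g₀) := by
        rcases min_choice s s' with h | h <;> rw [h]
        · exact ⟨g, hg, inf_le_left⟩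
        · exact ⟨g', hg', inf_le_right⟩
      have key := inf_le_inf hle hle'
      rw [inf_inf_inf_comm] at key
      by_cases h : max r r' < min s s'
      · rw [RatInterval.mk_inf_mk, dif_pos h]
        exact ⟨_, ⟨f₀, g₀, hf₀, hg₀, rfl⟩, key⟩
      · rw [RatInterval.mk_inf_mk, dif_neg h]
        refine ⟨⊥, rfl, key.trans (D_sub_inf_D_sub_eq_bot (hf₀.trans hg₀) ?_).le⟩
        exact_mod_cast not_lt.1 h

/-- Everything well inside `D_{f-r} ∧ D_{s-g}` is below the corresponding element of a slightly
smaller rational interval. -/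
theorem exists_rat_of_wellInside {f g : C.sa} {r s : ℚ} (hrs : r < s) {y : SpecLattice C}
    (hy : WellInside y (D (f - (r : ℝ) • (1 : C.sa)) ⊓ D ((s : ℝ) • (1 : C.sa) - g))) :
    ∃ r' s' : ℚ, r < r' ∧ s' < s ∧ r' < s' ∧
      y ≤ D (f - (r' : ℝ) • (1 : C.sa)) ⊓ D ((s' : ℝ) • (1 : C.sa) - g) := by
  obtain ⟨ε, hε, hyf⟩ := exists_wellInside_D_sub (hy.mono le_rfl inf_le_left)
  obtain ⟨δ, hδ, hyg⟩ := exists_wellInside_D_sub (hy.mono le_rfl inf_le_right)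
  have hrs' : (r : ℝ) < s := by exact_mod_cast hrs
  obtain ⟨η, hη, hη'⟩ := exists_rat_btwn
    (lt_min (lt_min hε hδ) (show (0 : ℝ) < (s - r) / 2 by linarith))
  simp only [lt_min_iff] at hη'
  have hη₀ : 0 < η := by exact_mod_cast hη
  refine ⟨r + η, s - η, by linarith, by linarith, ?_, le_inf (hyf.le.trans ?_) (hyg.le.trans ?_)⟩
  · have : ((r + η : ℚ) : ℝ) < ((s - η : ℚ) : ℝ) := by
      push_cast
      linarith
    exact_mod_cast this
  · rw [sub_sub, ← add_smul]
    refine D_sub_mono f ?_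
    push_cast
    linarith
  · have h (t : ℝ) : (s : ℝ) • (1 : C.sa) - g - t • (1 : C.sa) = (s - t : ℝ) • (1 : C.sa) - g := by
      rw [sub_smul]
      abel
    rw [Rat.cast_sub, ← h]
    exact D_sub_mono _ hη'.1.2.le

/-- The Daseinisation map is a continuous map of formal topologies. -/
theorem isContinuous_daseinStar (a : A) (ha : IsSelfAdjoint a) :
    IsContinuous (specCover A) (intervalCover (Context A)) (daseinStar a) where
  total _ x := exists_mem_daseinSet a ha x
  inf C i j E h := by
    rintro _ ⟨x, hx, y, hy, rfl⟩
    obtain ⟨z, hz, hle⟩ := exists_mem_daseinSet_inf hx hy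
    exact isCovering_specCover.covers_of_le (isCovering_specCover.refl E z _ hz) hle
  cover C i U hU E h x hx := by
    refine specCover_of_wellInside fun F hF y hy hy₀ => ?_
    have hx' := incl_mem_daseinSet a hF _ hx
    generalize hi : (i : RatInterval.{u}) = j at hx'
    cases j with
    | bot =>
      rw [daseinSet_bot hx'] at hy
      exact (hy₀ (le_bot_iff.1 hy.le)).elim
    | mk r s hrs =>
      obtain ⟨f, g, hf, hg, hfg⟩ := hx'
      rw [hfg] at hy
      obtain ⟨r', s', hr, hs, hrs', hle⟩ := exists_rat_of_wellInside hrs hy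
      obtain ⟨r'', s'', h'', hmem, hle'⟩ := hU r s hrs hi F (h.trans hF) r' s' hrs' hr hs
      refine ⟨_, ⟨_, hmem, f, g, hf, hg, rfl⟩, hle.trans (inf_le_inf ?_ ?_)⟩
      · exact D_sub_mono f (by exact_mod_cast hle'.1)
      · refine D_mono (sub_le_sub_right ?_ _)
        rw [algebraMap_coe_smul_one, algebraMap_coe_smul_one]
        exact algebraMap_mono A (by exact_mod_cast hle'.2)

end Context

theorem lemmaA15 {A : Type u} [CStarAlgebra A] [PartialOrder A] [StarOrderedRing A]
    (a : A) (ha : IsSelfAdjoint a) :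
    -- both are formal topologies in the topos
    IsCovering (Context.specCover A) ∧ IsCovering (intervalCover (Context A)) ∧
    -- the values of `d(a)^*`
    (∀ (C D : Context A) (h : C ≤ D) (r s : ℚ) (hrs : r < s),
      (valueAt (Context.daseinStar a) (p := C) (RatInterval.mk r s hrs)).stage D h =
        {x : Context.SpecLattice D | ∃ f g : D.sa, (f : A) ≤ a ∧ a ≤ (g : A) ∧
          x = Context.SpecLattice.D (f - (r : ℝ) • (1 : D.sa)) ⊓
            Context.SpecLattice.D ((s : ℝ) • (1 : D.sa) - g)}) ∧
    -- `d(a)` is continuous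
    IsContinuous (Context.specCover A) (intervalCover (Context A)) (Context.daseinStar a) ∧
    -- the induced frame map `U ↦ 𝒜 d(a)^*(U)`
    IsInternalFrame (opens (intervalCover (Context A))) ∧
    IsInternalFrame (opens (Context.specCover A)) ∧
    ∃ δ : opens (intervalCover (Context A)) ⟶ opens (Context.specCover A),
      IsFrameMap δ ∧
      ∀ (C : Context A) (U : (opens (intervalCover (Context A))).obj C),
        opens.toSub (δ.app C U) =
          (Context.specCover A).saturate (unionOver (Context.daseinStar a) (opens.toSub U)) :=
  have hS := Context.isCovering_specCover (A := A)
  have hI := isCovering_intervalCover (Context A)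
  have hd := Context.isContinuous_daseinStar a ha
  ⟨hS, hI, fun _ _ _ _ _ _ => rfl, hd, hI.isInternalFrame, hS.isInternalFrame,
    inducedMap hS _ _, hd.isFrameMap hS hI, fun _ _ => rfl⟩
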